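/- A coherent configuration (scheme) $\mathcal C=(V,\mathcal R)$ on a nonempty finite set $V$ is a partition $\mathcal R$ of $V\times V$ into nonempty relations, called basis relations, such that the diagonal of $V$ is a union of basis relations, the transpose of every basis relation is a basis relation, and for all $R,S,T\in\mathcal R$ the number of $w\in V$ with $(u,w)\in R$ and $(w,v)\in S$ is the same for all $(u,v)\in T$. A fiber of $\mathcal C$ is a nonempty set $X\subseteq V$ with $\{(x,x): x\in X\}\in\mathcal R$. For fibers $X,Y$ let $\mathcal R_{X,Y}=\{R\in\mathcal R: R\subseteq X\times Y\}$. The scheme $\mathcal C$ is $r$-balanced if $|\mathcal R_{X,Y}|=r$ for all fibers $X,Y$, and trivial if all its fibers are singletons. For a nonempty union $U$ of fibers, $\mathcal C_U$ denotes the restriction of $\mathcal C$ to $U$, i.e. the scheme on $U$ whose basis relations are the nonempty sets $R\cap(U\times U)$, $R\in\mathcal R$. If $V$ is the disjoint union of two nonempty unions of fibers $U_1$ and $U_2$, then $\mathcal C$ is the internal direct sum of $\mathcal C_1=\mathcal C_{U_1}$ and $\mathcal C_2=\mathcal C_{U_2}$, written $\mathcal C=\mathcal C_1\boxplus\mathcal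 C_2$, if $|\mathcal R_{X,Y}|=1$ for all fibers $X\subseteq U_1$ and $Y\subseteq U_2$. The adjacency algebra of $\mathcal C$ is the subalgebra of $\mathrm{Mat}_V(\mathbb C)$ spanned by the $\{0,1\}$-adjacency matrices of the basis relations, and $\mathcal P(\mathcal C)$ is the set of its central primitive idempotents, i.e. of the nonzero central idempotents that are not the sum of two nonzero orthogonal central idempotents. **Theorem.** Let $\mathcal C=(V,\mathcal R)$ be a coherent configuration on a nonempty finite set $V$. Then the following hold. (i) $|\mathcal P(\mathcal C)|=1$ if and only if $\mathcal C$ is $1$-balanced; moreover, $\mathcal C$ is $1$-balanced if and only if it is trivial. (ii) $|\mathcal P(\mathcal C)|=2$ if and only if either $\mathcal C$ is $2$-balanced, or $\mathcal C=\mathcal C_1\boxplus\mathcal C_2$ for some $\mathcal C_1,\mathcal C_2$ such that $\mathcal C_1$ is $1$-balanced and $\mathcal C_2$ is $2$-balanced. -/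

import Mathlib

/-- A coherent configuration (scheme) on the finite set `V`: a partition of `V × V` into nonempty
basis relations that refines the diagonal, is closed under transposition, and has well-defined
intersection numbers. -/
structure CoherentConfiguration (V : Type*) [Finite V] where
  /-- the set of basis relations -/
  relations : Set (Set (V × V))
  /-- The basis relations are nonempty and partition `V × V`. -/
  isPartition : Setoid.IsPartition relations
  /-- The diagonal is a union of basis relations. -/
  diagonal_eq : ∃ D ⊆ relations, Set.diagonal V = ⋃₀ D
  /-- The transpose of a basis relation is a basis relation. -/
  transpose_mem : ∀ R ∈ relations, {p : V × V | (p.2, p.1) ∈ R} ∈ relations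
  /-- The number of `w` with `(u, w) ∈ R` and `(w, v) ∈ S` is the same for all `(u, v) ∈ T`. -/
  intersection_const : ∀ R ∈ relations, ∀ S ∈ relations, ∀ T ∈ relations,
    ∀ u v u' v' : V, (u, v) ∈ T → (u', v') ∈ T →
      {w : V | (u, w) ∈ R ∧ (w, v) ∈ S}.ncard = {w : V | (u', w) ∈ R ∧ (w, v') ∈ S}.ncard

namespace CoherentConfiguration

section Basic

variable {V : Type*} [Finite V] (C : CoherentConfiguration V)

/-- The fibers: nonempty subsets `X` of `V` whose diagonal `Δ_X` is a basis relation. -/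
def fibers : Set (Set V) :=
  {X | X.Nonempty ∧ {p : V × V | p.1 = p.2 ∧ p.1 ∈ X} ∈ C.relations}

/-- The basis relations contained in `X × Y`. -/
def relationsBetween (X Y : Set V) : Set (Set (V × V)) :=
  {R | R ∈ C.relations ∧ R ⊆ X ×ˢ Y}

/-- `C` is `r`-balanced: there are exactly `r` basis relations inside `X × Y`, for all fibers
`X` and `Y`. -/
def IsBalanced (r : ℕ) : Prop :=
  ∀ X ∈ C.fibers, ∀ Y ∈ C.fibers, (C.relationsBetween X Y).ncard = r

/-- `C` is trivial: all its fibers are singletons. -/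
def IsTrivial : Prop :=
  ∀ X ∈ C.fibers, ∃ x : V, X = {x}

/-- The nonempty unions of fibers. -/
def fiberUnions : Set (Set V) :=
  {U | U.Nonempty ∧ ∃ F ⊆ C.fibers, U = ⋃₀ F}

theorem exists_relation (p : V × V) : ∃ R ∈ C.relations, p ∈ R :=
  (C.isPartition.2 p).exists

theorem relation_unique {R S : Set (V × V)} (hR : R ∈ C.relations) (hS : S ∈ C.relations)
    {p : V × V} (h1 : p ∈ R) (h2 : p ∈ S) : R = S :=
  (C.isPartition.2 p).unique ⟨hR, h1⟩ ⟨hS, h2⟩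

theorem eq_of_mem_diagonal_relation {R : Set (V × V)} (hR : R ∈ C.relations) {x : V}
    (hx : (x, x) ∈ R) {p : V × V} (hp : p ∈ R) : p.1 = p.2 := by
  obtain ⟨D, hD, h⟩ := C.diagonal_eq
  have hx' : (x, x) ∈ ⋃₀ D := by rw [← h]; exact Set.mem_diagonal x
  obtain ⟨S, hS, hxS⟩ := hx'
  have hRS := C.relation_unique hR (hD hS) hx hxS
  have : p ∈ Set.diagonal V := by rw [h]; exact ⟨S, hS, hRS ▸ hp⟩
  exact this

/-- If `(u, v)` and `(u', v')` lie in the same basis relation and a fiber contains `v`, then it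
contains `v'`. -/
theorem snd_mem_fiber {X : Set V} (hX : X ∈ C.fibers) {R : Set (V × V)} (hR : R ∈ C.relations)
    {u v u' v' : V} (h : (u, v) ∈ R) (h' : (u', v') ∈ R) (hv : v ∈ X) : v' ∈ X := by
  have hc := C.intersection_const R hR _ hX.2 R hR u v u' v' h h'
  have hne : {w : V | (u, w) ∈ R ∧ (w, v) ∈ {p : V × V | p.1 = p.2 ∧ p.1 ∈ X}}.ncard ≠ 0 :=
    Set.ncard_ne_zero_of_mem (a := v) ⟨h, rfl, hv⟩
  rw [hc] at hne
  obtain ⟨w, -, h1, h2⟩ := Set.nonempty_of_ncard_ne_zero hne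
  simp only at h1 h2
  exact h1 ▸ h2

theorem snd_mem_fiberUnion {U : Set V} (hU : U ∈ C.fiberUnions) {R : Set (V × V)}
    (hR : R ∈ C.relations) {u v u' v' : V} (h : (u, v) ∈ R) (h' : (u', v') ∈ R) (hv : v ∈ U) :
    v' ∈ U := by
  obtain ⟨-, F, hF, rfl⟩ := hU
  obtain ⟨X, hX, hvX⟩ := hv
  exact ⟨X, hX, C.snd_mem_fiber (hF hX) hR h h' hvX⟩

/-- The restriction `C_U` of `C` to a nonempty union `U` of fibers; its basis relations are the
nonempty sets among the `R ∩ (U × U)` with `R` a basis relation of `C`. -/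
def restrict (U : Set V) (hU : U ∈ C.fiberUnions) : CoherentConfiguration U where
  relations := {Q | Q.Nonempty ∧ ∃ R ∈ C.relations, Q = {p : U × U | ((p.1 : V), (p.2 : V)) ∈ R}}
  isPartition := by
    refine ⟨fun h => Set.not_nonempty_empty h.1, fun p => ?_⟩
    obtain ⟨R, hR, hp⟩ := C.exists_relation ((p.1 : V), (p.2 : V))
    refine ⟨{p : U × U | ((p.1 : V), (p.2 : V)) ∈ R}, ⟨⟨⟨p, hp⟩, R, hR, rfl⟩, hp⟩, ?_⟩
    rintro Q ⟨⟨-, S, hS, rfl⟩, hpS⟩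
    rw [C.relation_unique hS hR hpS hp]
  diagonal_eq := by
    refine ⟨{Q | (Q.Nonempty ∧ ∃ R ∈ C.relations,
      Q = {p : U × U | ((p.1 : V), (p.2 : V)) ∈ R}) ∧ Q ⊆ Set.diagonal U}, fun Q h => h.1, ?_⟩
    ext ⟨a, b⟩
    constructor
    · intro h
      have hab : a = b := h
      subst hab
      obtain ⟨R, hR, hp⟩ := C.exists_relation ((a : V), (a : V))
      exact ⟨_, ⟨⟨⟨(a, a), hp⟩, R, hR, rfl⟩, fun q hq =>
        Subtype.ext (C.eq_of_mem_diagonal_relation hR hp hq)⟩, hp⟩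
    · rintro ⟨Q, ⟨-, hQ⟩, hp⟩
      exact hQ hp
  transpose_mem := by
    rintro Q ⟨⟨⟨a, b⟩, hab⟩, R, hR, rfl⟩
    exact ⟨⟨(b, a), hab⟩, _, C.transpose_mem R hR, rfl⟩
  intersection_const := by
    rintro _ ⟨⟨⟨a, b⟩, hab⟩, R, hR, rfl⟩ _ ⟨-, S, hS, rfl⟩ _ ⟨-, T, hT, rfl⟩ u v u' v' h h'
    have key : ∀ x y : U, {w : U | (x, w) ∈ {p : U × U | ((p.1 : V), (p.2 : V)) ∈ R} ∧
        (w, y) ∈ {p : U × U | ((p.1 : V), (p.2 : V)) ∈ S}}.ncard =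
        {w : V | ((x : V), w) ∈ R ∧ (w, (y : V)) ∈ S}.ncard := by
      intro x y
      rw [← Set.ncard_image_of_injective _ Subtype.val_injective]
      congr 1
      ext w
      constructor
      · rintro ⟨w, hw, rfl⟩
        exact hw
      · intro hw
        exact ⟨⟨w, C.snd_mem_fiberUnion hU hR hab hw.1 b.2⟩, hw, rfl⟩
    rw [key, key]
    exact C.intersection_const R hR S hS T hT _ _ _ _ h h'

/-- `C` is the internal direct sum of its restrictions to `U` and `U'`, where `U` and `U'` are
disjoint nonempty unions of fibers that cover `V`: exactly one basis relation lies inside `X × Y`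
whenever `X ⊆ U` and `Y ⊆ U'` are fibers. -/
structure IsInternalDirectSum (U U' : Set V) : Prop where
  left_mem : U ∈ C.fiberUnions
  right_mem : U' ∈ C.fiberUnions
  disjoint : U ∩ U' = ∅
  cover : U ∪ U' = Set.univ
  one_relation : ∀ X ∈ C.fibers, ∀ Y ∈ C.fibers, X ⊆ U → Y ⊆ U' →
    (C.relationsBetween X Y).ncard = 1

end Basic

section Algebra

open Classical in
/-- The adjacency matrix of a relation. -/
noncomputable def adjMatrix {V : Type*} (R : Set (V × V)) : Matrix V V ℂ :=
  Matrix.of fun u v => if (u, v) ∈ R then 1 else 0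

variable {V : Type*} [Fintype V] (C : CoherentConfiguration V)

/-- The linear span of the adjacency matrices of the basis relations. -/
noncomputable def adjSpan : Submodule ℂ (Matrix V V ℂ) :=
  Submodule.span ℂ {M | ∃ R ∈ C.relations, M = adjMatrix R}

/-- A matrix that is constant on every basis relation lies in the span. -/
theorem mem_adjSpan_of_const (M : Matrix V V ℂ)
    (hM : ∀ R ∈ C.relations, ∀ u v u' v' : V, (u, v) ∈ R → (u', v') ∈ R → M u v = M u' v') :
    M ∈ C.adjSpan := by
  classical
  have hfin : C.relations.Finite := Set.toFinite _
  let c : Set (V × V) → ℂ := fun R => if h : R.Nonempty then M h.some.1 h.some.2 else 0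
  have hsum : M = ∑ R ∈ hfin.toFinset, c R • adjMatrix R := by
    ext u v
    obtain ⟨R, hR, hp⟩ := C.exists_relation (u, v)
    rw [Matrix.sum_apply, Finset.sum_eq_single R]
    · have hne : R.Nonempty := ⟨_, hp⟩
      have := hM R hR u v hne.some.1 hne.some.2 hp hne.some_mem
      simp [c, hne, adjMatrix, hp, this]
    · intro S hS hSR
      have hnot : (u, v) ∉ S := fun h =>
        hSR (C.relation_unique (hfin.mem_toFinset.1 hS) hR h hp)
      simp [adjMatrix, hnot]
    · intro h
      exact absurd (hfin.mem_toFinset.2 hR) h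
  rw [hsum]
  exact Submodule.sum_mem _ fun R hR =>
    Submodule.smul_mem _ _ (Submodule.subset_span ⟨R, hfin.mem_toFinset.1 hR, rfl⟩)

theorem adjMatrix_mul_mem {R S : Set (V × V)} (hR : R ∈ C.relations) (hS : S ∈ C.relations) :
    adjMatrix R * adjMatrix S ∈ C.adjSpan := by
  classical
  have key : ∀ u v : V, (adjMatrix R * adjMatrix S) u v =
      (({w : V | (u, w) ∈ R ∧ (w, v) ∈ S}.ncard : ℕ) : ℂ) := by
    intro u v
    rw [Matrix.mul_apply, Set.ncard_eq_toFinset_card']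
    simp only [adjMatrix, Matrix.of_apply, Set.toFinset_ofPred, ← ite_and, mul_ite, mul_one,
      mul_zero, Finset.sum_boole]
    congr 2
    ext w
    simp [and_comm]
  refine C.mem_adjSpan_of_const _ fun T hT u v u' v' h h' => ?_
  rw [key, key, C.intersection_const R hR S hS T hT u v u' v' h h']

theorem one_mem_adjSpan [DecidableEq V] : (1 : Matrix V V ℂ) ∈ C.adjSpan := by
  refine C.mem_adjSpan_of_const _ fun R hR u v u' v' h h' => ?_
  by_cases huv : u = v
  · subst huv
    have h2 : u' = v' := C.eq_of_mem_diagonal_relation hR h h'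
    subst h2
    simp
  · have h2 : u' ≠ v' := by
      rintro rfl
      exact huv (C.eq_of_mem_diagonal_relation hR h' h)
    simp [huv, h2]

/-- The adjacency algebra: the linear span of the adjacency matrices of the basis relations, as a
subalgebra of the full complex matrix algebra. -/
noncomputable def adjacencyAlgebra [DecidableEq V] : Subalgebra ℂ (Matrix V V ℂ) :=
  C.adjSpan.toSubalgebra C.one_mem_adjSpan (by
    intro x y hx hy
    refine Submodule.span_induction₂ (p := fun x y _ _ => x * y ∈ C.adjSpan)
      ?_ ?_ ?_ ?_ ?_ ?_ ?_ hx hy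
    · rintro _ _ ⟨R, hR, rfl⟩ ⟨S, hS, rfl⟩
      exact C.adjMatrix_mul_mem hR hS
    · intro y _
      rw [zero_mul]
      exact Submodule.zero_mem _
    · intro x _
      rw [mul_zero]
      exact Submodule.zero_mem _
    · intro x y z _ _ _ h1 h2
      rw [add_mul]
      exact Submodule.add_mem _ h1 h2
    · intro x y z _ _ _ h1 h2
      rw [mul_add]
      exact Submodule.add_mem _ h1 h2
    · intro r x y _ _ h
      rw [smul_mul_assoc]
      exact Submodule.smul_mem _ _ h
    · intro r x y _ _ h
      rw [mul_smul_comm]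
      exact Submodule.smul_mem _ _ h)

/-- `e` is a central primitive idempotent of the ring `A`: a nonzero central idempotent that is
not the sum of two nonzero orthogonal central idempotents. -/
def IsCentralPrimitiveIdempotent {A : Type*} [Ring A] (e : A) : Prop :=
  e ≠ 0 ∧ IsIdempotentElem e ∧ e ∈ Set.center A ∧
    ∀ f g : A, IsIdempotentElem f → f ∈ Set.center A → IsIdempotentElem g → g ∈ Set.center A →
      f * g = 0 → e = f + g → f = 0 ∨ g = 0

/-- The set of central primitive idempotents of the adjacency algebra. -/
def centralPrimitiveIdempotents [DecidableEq V] : Set C.adjacencyAlgebra :=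
  {P | IsCentralPrimitiveIdempotent P}

end Algebra

end CoherentConfiguration

/-!
The adjacency algebra `A` is closed under conjugate transposition, hence semisimple, and by
Wedderburn-Artin `A ≃ Π i, Mat (d i)`, with as many factors as there are central primitive
idempotents. For a fiber `X` let `E_X` be the adjacency matrix of its diagonal and `n i X` the rank
of its `i`-th component. The projection `M ↦ E_X * M * E_Y` of `A` has trace `|R_{X,Y}|` in the
basis of adjacency matrices and trace `∑ i, n i X * n i Y` in the product, so
`|R_{X,Y}| = ∑ i, n i X * n i Y` (`exists_multiplicities`). The rank one matrices `|X|⁻¹ J_X` all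
lie in one component, the principal one, where every fiber has multiplicity `1`
(`exists_principal`, `trace_principal_fiberIdempotent`).

If there is one component, this gives `|R_{X,Y}| = 1`. If there are two, then
`|R_{X,Y}| = 1 + a X * a Y`, where `a` is the multiplicity in the nonprincipal component, and the
heart of the proof is that `a X ≤ 1` (`multiplicity_le_one`): the nonprincipal character takes
rational values that are algebraic integers on the adjacency matrices, which bounds the valencies of
the `a X ^ 2` nondiagonal relations of `X` from below, while these valencies add up to `|X| - 1`.
The fibers with `a = 0` and those with `a = 1` then form the two parts of a direct sum, unless
the former do not exist.

Conversely, if all `|R_{X,Y}|` are equal to `r`, then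
`∑ i, (n i X - n i Y) ^ 2 = r - 2 * r + r = 0`, so all multiplicity vectors coincide
(`eq_of_sum_mul_eq`). They have no zero entry since `∑ X, E_X = 1`, and for `r ≤ 2` this forces
all entries to be `1` and the number of components to be `r`. The same argument on the two parts of
a direct sum yields two components there (`card_eq_two_of_directSum`).
-/

/-! ### Matrices and products of matrix algebras -/

/-- The trace is the sum of the eigenvalues, and these are roots of any monic integer polynomial
that annihilates the matrix. -/
theorem Matrix.isIntegral_trace {n : Type*} [Fintype n] [DecidableEq n] {M : Matrix n n ℂ}
    (hM : IsIntegral ℤ M) : IsIntegral ℤ M.trace := by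
  rw [Matrix.trace_eq_sum_roots_charpoly]
  refine IsIntegral.multiset_sum fun r hr => ?_
  have hroot : M.charpoly.IsRoot r := (Polynomial.mem_roots'.1 hr).2
  have hspec : r ∈ spectrum ℂ M := Matrix.mem_spectrum_iff_isRoot_charpoly.2 hroot
  obtain ⟨p, hp, hpM⟩ := hM
  refine ⟨p, hp, ?_⟩
  have : Nontrivial (Matrix n n ℂ) := by
    by_contra h
    rw [not_nontrivial_iff_subsingleton] at h
    rw [spectrum.of_subsingleton] at hspec
    exact hspec
  have h1 := spectrum.subset_polynomial_aeval M (p.map (algebraMap ℤ ℂ))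
    (Set.mem_image_of_mem (fun k => Polynomial.eval k (p.map (algebraMap ℤ ℂ))) hspec)
  rw [Polynomial.aeval_map_algebraMap] at h1
  have h2 : Polynomial.aeval M p = 0 := hpM
  rw [h2, spectrum.zero_eq, Set.mem_singleton_iff, Polynomial.eval_map] at h1
  exact h1

theorem Matrix.exists_natCast_eq_trace {n : Type*} [Fintype n] [DecidableEq n] {E : Matrix n n ℂ}
    (hE : IsIdempotentElem E) : ∃ k : ℕ, E.trace = k := by
  have h : IsIdempotentElem (Matrix.toLinAlgEquiv' E) := hE.map Matrix.toLinAlgEquiv'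
  refine ⟨_, (Matrix.trace_toLin'_eq E).symm.trans
    (LinearMap.IsProj.trace (LinearMap.IsIdempotentElem.isProj_range _ h))⟩

/-- A linear functional on a matrix algebra that vanishes on commutators is a multiple of the
trace. -/
theorem Matrix.exists_eq_mul_trace {n : Type*} [Fintype n] [DecidableEq n]
    (f : Matrix n n ℂ →ₗ[ℂ] ℂ) (hf : ∀ x y, f (x * y) = f (y * x)) :
    ∃ c : ℂ, ∀ x, f x = c * x.trace := by
  rcases isEmpty_or_nonempty n with h | ⟨⟨k⟩⟩
  · exact ⟨0, fun x => by rw [Subsingleton.elim x 0]; simp⟩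
  refine ⟨f (Matrix.single k k 1), fun x => ?_⟩
  have key : ∀ i j c, f (Matrix.single i j c) =
      f (Matrix.single k k 1) * (Matrix.single i j c).trace := by
    intro i j c
    have h1 : Matrix.single i j c = Matrix.single i k c * Matrix.single k j 1 := by simp
    rw [h1, hf, Matrix.trace_mul_comm]
    by_cases hij : j = i
    · subst hij
      have h2 : Matrix.single k k c = c • Matrix.single k k (1 : ℂ) := by simp
      rw [Matrix.single_mul_single_same, one_mul, h2, map_smul]
      simp [mul_comm]
    · simp [Matrix.single_mul_single_of_ne, hij]
  rw [Matrix.matrix_eq_sum_single x]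
  simp only [map_sum, Matrix.trace_sum, Finset.mul_sum]
  exact Finset.sum_congr rfl fun i _ => Finset.sum_congr rfl fun j _ => key i j _

section PiMatrix

variable {ι : Type*} [Fintype ι] [DecidableEq ι] {d : ι → ℕ}

/-- A linear functional on a product of matrix algebras that vanishes on commutators is a
combination of the traces of the components. -/
theorem exists_tracial_eq_sum (f : (Π i, Matrix (Fin (d i)) (Fin (d i)) ℂ) →ₗ[ℂ] ℂ)
    (hf : ∀ x y, f (x * y) = f (y * x)) :
    ∃ m : ι → ℂ, ∀ x, f x = ∑ i, m i * (x i).trace := by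
  have h : ∀ i, ∃ c : ℂ, ∀ x, f (Pi.single i x) = c * x.trace := fun i =>
    Matrix.exists_eq_mul_trace
      (f ∘ₗ LinearMap.single ℂ (fun i => Matrix (Fin (d i)) (Fin (d i)) ℂ) i) fun x y => by
        simp [Pi.single_mul, hf]
  choose m hm using h
  refine ⟨m, fun x => ?_⟩
  conv_lhs => rw [← Finset.univ_sum_single x]
  simp [hm]

/-- The two-sided multiplication `x ↦ u * x * v` of a product of matrix algebras is a direct sum of
tensor products, so its trace is `∑ i, tr uᵢ * tr vᵢ`. -/
theorem trace_mulLeft_comp_mulRight_pi (u v : Π i, Matrix (Fin (d i)) (Fin (d i)) ℂ) :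
    LinearMap.trace ℂ _ (LinearMap.mulLeft ℂ u ∘ₗ LinearMap.mulRight ℂ v) =
      ∑ i, (u i).trace * (v i).trace := by
  rw [LinearMap.trace_eq_matrix_trace ℂ
      (Pi.basis fun i => Matrix.stdBasis ℂ (Fin (d i)) (Fin (d i))),
    Matrix.trace, Fintype.sum_sigma]
  refine Finset.sum_congr rfl fun i _ => ?_
  rw [Fintype.sum_prod_type, Matrix.trace, Matrix.trace, Finset.sum_mul_sum]
  refine Finset.sum_congr rfl fun p _ => Finset.sum_congr rfl fun q _ => ?_
  simp only [Matrix.diag_apply, LinearMap.toMatrix_apply, Pi.basis_apply, Pi.basis_repr,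
    LinearMap.comp_apply, LinearMap.mulLeft_apply, LinearMap.mulRight_apply, Pi.mul_apply,
    Pi.single_eq_same, Matrix.stdBasis_eq_single]
  change (u i * ((Matrix.single p q 1 : Matrix (Fin (d i)) (Fin (d i)) ℂ) * v i)) p q = _
  rw [← Matrix.mul_assoc, Matrix.mul_apply, Finset.sum_eq_single q]
  · simp
  · intro j _ hj
    rw [Matrix.mul_single_apply_of_ne _ _ _ _ _ hj, zero_mul]
  · simp

end PiMatrix

namespace CoherentConfiguration

theorem map_mem_center {A B : Type*} [Ring A] [Ring B] (φ : A ≃+* B) {x : A}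
    (hx : x ∈ Set.center A) : φ x ∈ Set.center B := by
  rw [Semigroup.mem_center_iff] at hx ⊢
  intro y
  rw [← φ.apply_symm_apply y, ← map_mul, ← map_mul, hx]

theorem IsCentralPrimitiveIdempotent.map {A B : Type*} [Ring A] [Ring B] (φ : A ≃+* B) {e : A}
    (h : IsCentralPrimitiveIdempotent e) : IsCentralPrimitiveIdempotent (φ e) := by
  obtain ⟨h0, h1, h2, h3⟩ := h
  refine ⟨by simpa using h0, h1.map φ, map_mem_center φ h2, fun f g hf hfc hg hgc hfg heq => ?_⟩
  have := h3 (φ.symm f) (φ.symm g) (hf.map φ.symm) ?_ (hg.map φ.symm) ?_ (by simp [← map_mul, hfg])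
    (by rw [← map_add, ← heq]; simp)
  · simpa using this
  · exact map_mem_center φ.symm hfc
  · exact map_mem_center φ.symm hgc

/-- The central primitive idempotents of a product of matrix algebras are the identities of the
factors. -/
theorem isCentralPrimitiveIdempotent_pi_iff {ι : Type*} [Fintype ι] [DecidableEq ι] {d : ι → ℕ}
    (hd : ∀ i, d i ≠ 0) (e : Π i, Matrix (Fin (d i)) (Fin (d i)) ℂ) :
    IsCentralPrimitiveIdempotent e ↔ ∃ i, e = Pi.single i 1 := by
  have : ∀ i, NeZero (d i) := fun i => ⟨hd i⟩
  have hcen : ∀ i, (Pi.single i 1 : Π i, Matrix (Fin (d i)) (Fin (d i)) ℂ) ∈ Set.center _ := by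
    intro i
    rw [Semigroup.mem_center_iff]
    intro y
    ext1 j
    by_cases h : j = i
    · subst h; simp
    · simp [h]
  have hidem : ∀ i, IsIdempotentElem (Pi.single i 1 : Π i, Matrix (Fin (d i)) (Fin (d i)) ℂ) := by
    intro i
    rw [IsIdempotentElem, ← Pi.single_mul, one_mul]
  -- the center of a matrix algebra consists of scalars, so its only idempotents are 0 and 1
  have h01 : ∀ f : Π i, Matrix (Fin (d i)) (Fin (d i)) ℂ, IsIdempotentElem f → f ∈ Set.center _ →
      ∀ i, f i = 0 ∨ f i = 1 := by
    intro f hf hfc i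
    have hi : f i ∈ Subalgebra.center ℂ (Matrix (Fin (d i)) (Fin (d i)) ℂ) := by
      rw [Subalgebra.mem_center_iff]
      intro y
      rw [Semigroup.mem_center_iff] at hfc
      simpa using congrFun (hfc (Pi.single i y)) i
    obtain ⟨c, hc⟩ := (Algebra.IsCentral.mem_center_iff ℂ).1 hi
    have h2 : f i * f i = f i := congrFun hf i
    rw [hc, ← map_mul] at h2
    have h3 : c * c = c := FaithfulSMul.algebraMap_injective ℂ _ h2
    by_cases h0 : c = 0
    · left; rw [hc, h0, map_zero]
    · right; rw [hc, mul_eq_left₀ h0 |>.1 h3, map_one]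
  constructor
  · rintro ⟨h0, h1, h2, h3⟩
    obtain ⟨i, hi⟩ := Function.ne_iff.1 h0
    have hi1 : e i = 1 := (h01 e h1 h2 i).resolve_left hi
    have hmul : Pi.single i 1 * e = Pi.single i 1 := by
      ext1 j
      by_cases h : j = i
      · subst h; simp [hi1]
      · simp [h]
    have hmul' : e * Pi.single i 1 = Pi.single i 1 := by
      rw [Semigroup.mem_center_iff.1 (hcen i) e, hmul]
    refine ⟨i, ?_⟩
    have hsub : IsIdempotentElem (e - Pi.single i 1) := by
      rw [IsIdempotentElem, mul_sub, sub_mul, sub_mul, hmul, hmul', (hidem i).eq, h1.eq, sub_self,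
        sub_zero]
    have hsubc : e - Pi.single i 1 ∈ Set.center (Π i, Matrix (Fin (d i)) (Fin (d i)) ℂ) := by
      rw [Semigroup.mem_center_iff] at h2 ⊢
      intro y
      rw [mul_sub, sub_mul, h2, Semigroup.mem_center_iff.1 (hcen i)]
    rcases h3 (Pi.single i 1) (e - Pi.single i 1) (hidem i) (hcen i) hsub hsubc
      (by rw [mul_sub, hmul, (hidem i).eq, sub_self]) (by simp) with h | h
    · have := congrFun h i
      simp at this
    · exact sub_eq_zero.1 h
  · rintro ⟨i, rfl⟩
    refine ⟨fun h => ?_, hidem i, hcen i, fun f g hf hfc hg hgc hfg heq => ?_⟩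
    · have := congrFun h i
      simp at this
    have hj : ∀ j, j ≠ i → f j + g j = 0 := by
      intro j h
      have := congrFun heq j
      simpa [h] using this.symm
    have hfj : ∀ j, j ≠ i → f j = 0 := by
      intro j h
      have h1 : f j * f j = f j := congrFun hf j
      have h2 : f j * g j = 0 := congrFun hfg j
      calc f j = f j * (f j + g j) := by rw [mul_add, h1, h2, add_zero]
        _ = 0 := by rw [hj j h, mul_zero]
    have hgj : ∀ j, j ≠ i → g j = 0 := by
      intro j h
      simpa [hfj j h] using hj j h
    have hi : f i * g i = 0 := congrFun hfg i
    have hor : f i = 0 ∨ g i = 0 := by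
      rcases h01 f hf hfc i with h | h
      · exact Or.inl h
      · right; simpa [h] using hi
    refine hor.imp (fun h => ?_) fun h => ?_
    · ext1 j
      by_cases hji : j = i
      · subst hji; exact h
      · exact hfj j hji
    · ext1 j
      by_cases hji : j = i
      · subst hji; exact h
      · exact hgj j hji

/-- The central primitive idempotents of an algebra isomorphic to a product of matrix algebras
are in bijection with the factors. -/
theorem ncard_isCentralPrimitiveIdempotent {ι A : Type*} [Fintype ι] [DecidableEq ι] [Ring A]
    [Algebra ℂ A] {d : ι → ℕ} (hd : ∀ i, d i ≠ 0)
    (φ : A ≃ₐ[ℂ] Π i, Matrix (Fin (d i)) (Fin (d i)) ℂ) :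
    {e : A | IsCentralPrimitiveIdempotent e}.ncard = Fintype.card ι := by
  have : ∀ i, NeZero (d i) := fun i => ⟨hd i⟩
  have himage : φ '' {e : A | IsCentralPrimitiveIdempotent e} =
      Set.range fun i => (Pi.single i 1 : Π i, Matrix (Fin (d i)) (Fin (d i)) ℂ) := by
    ext e
    constructor
    · rintro ⟨e, he, rfl⟩
      obtain ⟨i, hi⟩ := (isCentralPrimitiveIdempotent_pi_iff hd _).1 (he.map φ.toRingEquiv)
      exact ⟨i, hi.symm⟩
    · rintro ⟨i, rfl⟩
      exact ⟨φ.symm (Pi.single i 1), ((isCentralPrimitiveIdempotent_pi_iff hd _).2 ⟨i, rfl⟩).map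
        φ.symm.toRingEquiv, φ.apply_symm_apply _⟩
  have hinj : Function.Injective
      fun i => (Pi.single i 1 : Π i, Matrix (Fin (d i)) (Fin (d i)) ℂ) := by
    intro i j hij
    by_contra h
    have := congrFun hij i
    simp [h] at this
  rw [← Set.ncard_image_of_injective _ φ.injective, himage, ← Nat.card_coe_set_eq,
    Nat.card_range_of_injective hinj, Nat.card_eq_fintype_card]

end CoherentConfiguration

open scoped ComplexOrder in
/-- A subalgebra of a matrix algebra that is closed under conjugate transposition is semisimple:
an element `x` of its radical makes `xᴴ * x` nilpotent, hence of trace zero. -/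
theorem Subalgebra.isSemisimpleRing_of_conjTranspose_mem {n : Type*} [Fintype n] [DecidableEq n]
    (A : Subalgebra ℂ (Matrix n n ℂ)) (hA : ∀ M ∈ A, M.conjTranspose ∈ A) :
    IsSemisimpleRing A := by
  have : IsArtinianRing A := IsArtinianRing.of_finite ℂ A
  rw [IsArtinianRing.isSemisimpleRing_iff_jacobson, eq_bot_iff]
  intro x hx
  have hy : (⟨_, hA x x.2⟩ : A) * x ∈ Ring.jacobson A := Ideal.mul_mem_left _ _ hx
  obtain ⟨k, hk⟩ := IsSemiprimaryRing.isNilpotent (R := A)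
  have hnil : IsNilpotent ((⟨_, hA x x.2⟩ : A) * x) := by
    refine ⟨k, ?_⟩
    have := Ideal.pow_mem_pow hy k
    rw [hk] at this
    exact this
  have hnil' : IsNilpotent ((x : Matrix n n ℂ).conjTranspose * x) := hnil.map A.val
  have htr := (Matrix.isNilpotent_trace_of_isNilpotent hnil').eq_zero
  rw [Matrix.trace_conjTranspose_mul_self_eq_zero_iff] at htr
  exact Subtype.ext htr

/-! ### Gram matrices of multiplicity vectors -/



section Gram

variable {ι F : Type*} [Fintype ι] {n : ι → F → ℕ} {r : ℕ}

/-- If all inner products of the vectors `n · X` are equal to `r`, then these vectors coincide,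
because `∑ i, (n i X - n i Y) ^ 2 = r - 2 * r + r = 0`. -/
theorem eq_of_sum_mul_eq (h : ∀ X Y, ∑ i, n i X * n i Y = r) (X Y : F) (i : ι) :
    n i X = n i Y := by
  have hs : ∑ i, ((n i X : ℤ) - n i Y) ^ 2 = 0 := by
    have e : ∀ i, ((n i X : ℤ) - n i Y) ^ 2 =
        ((n i X * n i X : ℕ) : ℤ) - 2 * ((n i X * n i Y : ℕ) : ℤ) + ((n i Y * n i Y : ℕ) : ℤ) := by
      intro i; push_cast; ring
    rw [Finset.sum_congr rfl fun i _ => e i, Finset.sum_add_distrib, Finset.sum_sub_distrib,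
      ← Finset.mul_sum, ← Nat.cast_sum, ← Nat.cast_sum, ← Nat.cast_sum, h, h, h]
    ring
  have := (Finset.sum_eq_zero_iff_of_nonneg fun i _ => sq_nonneg _).1 hs i (Finset.mem_univ i)
  have h2 := pow_eq_zero_iff (two_ne_zero) |>.1 this
  omega

/-- The common vector has only nonzero entries, and they are `1` because `r < 4`. -/
theorem card_eq_of_sum_mul_eq [Nonempty F] (h : ∀ X Y, ∑ i, n i X * n i Y = r) (hr : r ≤ 3)
    (hpos : ∀ i, ∃ X, n i X ≠ 0) : Fintype.card ι = r := by
  obtain ⟨X⟩ := ‹Nonempty F›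
  have h0 : ∀ i, n i X ≠ 0 := fun i => by
    obtain ⟨Y, hY⟩ := hpos i
    rwa [eq_of_sum_mul_eq h X Y i]
  have h1 : ∀ i, n i X * n i X = 1 := by
    intro i
    have hle : n i X * n i X ≤ r := by
      rw [← h X X]
      exact Finset.single_le_sum (f := fun i => n i X * n i X) (fun _ _ => Nat.zero_le _)
        (Finset.mem_univ i)
    have hlt : n i X < 2 := by
      by_contra hc
      have : 2 * 2 ≤ n i X * n i X := Nat.mul_le_mul (by omega) (by omega)
      omega
    have : n i X = 1 := by have := h0 i; omega
    simp [this]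
  rw [← h X X, Finset.sum_congr rfl fun i _ => h1 i]
  simp

end Gram

namespace CoherentConfiguration

/-! ### Fibers, basis relations and restrictions -/

section Fibers

variable {V : Type*} [Finite V] (C : CoherentConfiguration V)

theorem relation_nonempty {R : Set (V × V)} (hR : R ∈ C.relations) : R.Nonempty :=
  Set.nonempty_iff_ne_empty.2 fun h => C.isPartition.1 (h ▸ hR)

theorem exists_fiber (v : V) : ∃ X ∈ C.fibers, v ∈ X := by
  obtain ⟨R, hR, hv⟩ := C.exists_relation (v, v)
  refine ⟨{x | (x, x) ∈ R}, ⟨⟨v, hv⟩, ?_⟩, hv⟩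
  convert hR using 1
  ext ⟨x, y⟩
  constructor
  · rintro ⟨h1, h2⟩
    simp only at h1 h2
    subst h1
    exact h2
  · intro h
    have hxy : x = y := C.eq_of_mem_diagonal_relation hR hv h
    subst hxy
    exact ⟨rfl, h⟩

theorem fiber_unique {X Y : Set V} (hX : X ∈ C.fibers) (hY : Y ∈ C.fibers) {v : V} (hvX : v ∈ X)
    (hvY : v ∈ Y) : X = Y := by
  have h := C.relation_unique hX.2 hY.2 (p := (v, v)) ⟨rfl, hvX⟩ ⟨rfl, hvY⟩
  ext x
  simpa using Set.ext_iff.1 h (x, x)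

theorem subset_prod_of_mem {X Y : Set V} (hX : X ∈ C.fibers) (hY : Y ∈ C.fibers)
    {R : Set (V × V)} (hR : R ∈ C.relations) {p : V × V} (hp : p ∈ R) (h1 : p.1 ∈ X)
    (h2 : p.2 ∈ Y) : R ⊆ X ×ˢ Y := fun q hq =>
  ⟨C.snd_mem_fiber hX (C.transpose_mem R hR) (u := p.2) (v := p.1) (u' := q.2) (v' := q.1) hp hq h1,
    C.snd_mem_fiber hY hR (u := p.1) (v := p.2) (u' := q.1) (v' := q.2) hp hq h2⟩

theorem ncard_out_eq {X Y : Set V} (hX : X ∈ C.fibers) {R : Set (V × V)}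
    (hR : R ∈ C.relationsBetween X Y) {u u' : V} (hu : u ∈ X) (hu' : u' ∈ X) :
    {w | (u, w) ∈ R}.ncard = {w | (u', w) ∈ R}.ncard := by
  have := C.intersection_const R hR.1 _ (C.transpose_mem R hR.1) _ hX.2 u u u' u'
    ⟨rfl, hu⟩ ⟨rfl, hu'⟩
  simpa using this

theorem diagonal_mem_relationsBetween {X : Set V} (hX : X ∈ C.fibers) :
    {p : V × V | p.1 = p.2 ∧ p.1 ∈ X} ∈ C.relationsBetween X X :=
  ⟨hX.2, fun _ hp => ⟨hp.2, hp.1 ▸ hp.2⟩⟩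

/-- The valencies of the basis relations between `X` and `X` add up to `|X|`. -/
theorem sum_ncard_out {X : Set V} (hX : X ∈ C.fibers) {x : V} (hx : x ∈ X) :
    ∑ R ∈ (Set.toFinite (C.relationsBetween X X)).toFinset, {w | (x, w) ∈ R}.ncard = X.ncard := by
  classical
  choose rel hrel hmem using C.exists_relation
  rw [← Set.toFinite X |>.coe_toFinset, Set.ncard_coe_finset,
    Finset.card_eq_sum_card_fiberwise (f := fun w => rel (x, w))
      (t := (Set.toFinite (C.relationsBetween X X)).toFinset)]
  · simp only [Set.Finite.coe_toFinset]
    refine Finset.sum_congr rfl fun R hR => ?_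
    have hR' : R ∈ C.relationsBetween X X := by simpa using hR
    rw [← Set.ncard_coe_finset]
    congr 1
    ext w
    simp only [Finset.coe_filter, Set.Finite.mem_toFinset, Set.mem_ofPred_eq]
    constructor
    · intro h
      exact ⟨(hR'.2 h).2, C.relation_unique (hrel _) hR'.1 (hmem _) h⟩
    · rintro ⟨-, h⟩
      rw [← h]
      exact hmem _
  · intro w hw
    have hw' : w ∈ X := by simpa using hw
    rw [Set.Finite.coe_toFinset]
    exact ⟨hrel _, C.subset_prod_of_mem hX hX (hrel _) (hmem _) hx hw'⟩

/-- A chosen element of a basis relation. -/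
noncomputable def point (R : C.relations) : V × V := (C.relation_nonempty R.2).some

theorem point_mem (R : C.relations) : C.point R ∈ (R : Set (V × V)) :=
  (C.relation_nonempty R.2).some_mem

variable {U : Set V} (hU : U ∈ C.fiberUnions)

theorem mem_relations_restrict_iff (Q : Set (U × U)) :
    Q ∈ (C.restrict U hU).relations ↔ Prod.map Subtype.val Subtype.val '' Q ∈ C.relations := by
  constructor
  · rintro ⟨⟨⟨a, b⟩, hab⟩, R, hR, rfl⟩
    convert hR using 1
    ext ⟨x, y⟩
    constructor
    · rintro ⟨q, hq, h⟩
      rw [← h]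
      exact hq
    · intro h
      exact ⟨(⟨x, C.snd_mem_fiberUnion hU (C.transpose_mem R hR) (u := b) (v := a) (u' := y)
        (v' := x) hab h a.2⟩, ⟨y, C.snd_mem_fiberUnion hU hR hab h b.2⟩), h, rfl⟩
  · intro h
    refine ⟨(C.relation_nonempty h).of_image, _, h, ?_⟩
    have hinj : Function.Injective (Prod.map (Subtype.val : U → V) (Subtype.val : U → V)) :=
      Subtype.val_injective.prodMap Subtype.val_injective
    exact (Set.preimage_image_eq Q hinj).symm

theorem mem_fibers_restrict_iff (X : Set U) :
    X ∈ (C.restrict U hU).fibers ↔ Subtype.val '' X ∈ C.fibers := by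
  have h : Prod.map Subtype.val Subtype.val '' {p : U × U | p.1 = p.2 ∧ p.1 ∈ X} =
      {p : V × V | p.1 = p.2 ∧ p.1 ∈ Subtype.val '' X} := by
    ext ⟨x, y⟩
    constructor
    · rintro ⟨⟨a, b⟩, ⟨h1, h2⟩, h3⟩
      simp only [Prod.map_apply, Prod.mk.injEq] at h1 h3
      exact ⟨by simp [← h3.1, ← h3.2, h1], a, h2, h3.1⟩
    · rintro ⟨h1, a, h2, h3⟩
      simp only at h1 h3
      exact ⟨(a, a), ⟨rfl, h2⟩, by simp [h3, ← h1]⟩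
  rw [fibers, Set.mem_ofPred_eq, mem_relations_restrict_iff, h, fibers, Set.mem_ofPred_eq,
    Set.image_nonempty]

theorem ncard_relationsBetween_restrict (X Y : Set U) :
    ((C.restrict U hU).relationsBetween X Y).ncard =
      (C.relationsBetween (Subtype.val '' X) (Subtype.val '' Y)).ncard := by
  have hinj : Function.Injective (Prod.map (Subtype.val : U → V) (Subtype.val : U → V)) :=
    Subtype.val_injective.prodMap Subtype.val_injective
  rw [← Set.ncard_image_of_injective _ hinj.image_injective]
  congr 1
  ext R
  constructor
  · rintro ⟨Q, ⟨hQ, hQXY⟩, rfl⟩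
    refine ⟨(C.mem_relations_restrict_iff hU Q).1 hQ, ?_⟩
    rw [← Set.prodMap_image_prod]
    exact Set.image_mono hQXY
  · rintro ⟨hR, hRXY⟩
    rw [← Set.prodMap_image_prod] at hRXY
    obtain ⟨Q, hQ, rfl⟩ := Set.subset_image_iff.1 hRXY
    exact ⟨Q, ⟨(C.mem_relations_restrict_iff hU Q).2 hR, hQ⟩, rfl⟩

theorem isBalanced_restrict_iff (r : ℕ) :
    (C.restrict U hU).IsBalanced r ↔ ∀ X ∈ C.fibers, ∀ Y ∈ C.fibers, X ⊆ U → Y ⊆ U →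
      (C.relationsBetween X Y).ncard = r := by
  constructor
  · intro h X hX Y hY hXU hYU
    obtain ⟨X', rfl⟩ := (Set.subset_range_iff_exists_image_eq (f := (Subtype.val : U → V))).1
      (by simpa using hXU)
    obtain ⟨Y', rfl⟩ := (Set.subset_range_iff_exists_image_eq (f := (Subtype.val : U → V))).1
      (by simpa using hYU)
    rw [← C.ncard_relationsBetween_restrict hU]
    exact h _ ((C.mem_fibers_restrict_iff hU _).2 hX) _ ((C.mem_fibers_restrict_iff hU _).2 hY)
  · intro h X hX Y hY
    rw [C.ncard_relationsBetween_restrict hU]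
    exact h _ ((C.mem_fibers_restrict_iff hU _).1 hX) _ ((C.mem_fibers_restrict_iff hU _).1 hY)
      (by simp) (by simp)

end Fibers

/-! ### The adjacency algebra -/

open Classical in
theorem adjMatrix_diagonal {V : Type*} [DecidableEq V] (X : Set V) :
    adjMatrix {p : V × V | p.1 = p.2 ∧ p.1 ∈ X} =
      Matrix.diagonal fun v => if v ∈ X then (1 : ℂ) else 0 := by
  ext u v
  by_cases h : u = v
  · subst h; simp [adjMatrix]
  · simp [adjMatrix, h]

section Trace

variable {V : Type*} [Fintype V] [DecidableEq V] (C : CoherentConfiguration V)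

/-- The adjacency algebra consists of the matrices that are constant on the basis relations. -/
theorem mem_adjacencyAlgebra_iff {M : Matrix V V ℂ} :
    M ∈ C.adjacencyAlgebra ↔ ∀ R ∈ C.relations, ∀ p ∈ R, ∀ q ∈ R, M p.1 p.2 = M q.1 q.2 := by
  constructor
  · intro hM
    refine Submodule.span_induction (p := fun M _ => ∀ R ∈ C.relations, ∀ p ∈ R, ∀ q ∈ R,
      M p.1 p.2 = M q.1 q.2) ?_ ?_ ?_ ?_ (show M ∈ C.adjSpan from hM)
    · rintro _ ⟨S, hS, rfl⟩ R hR p hp q hq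
      by_cases h : R = S
      · subst h; simp [adjMatrix, hp, hq]
      · have h1 : ∀ p ∈ R, p ∉ S := fun p h1 h2 => h (C.relation_unique hR hS h1 h2)
        simp [adjMatrix, h1 p hp, h1 q hq]
    · simp
    · intro x y _ _ hx hy R hR p hp q hq
      simp [hx R hR p hp q hq, hy R hR p hp q hq]
    · intro a x _ hx R hR p hp q hq
      simp [hx R hR p hp q hq]
  · intro h
    exact C.mem_adjSpan_of_const M fun R hR u v u' v' h1 h2 => h R hR (u, v) h1 (u', v') h2

theorem adjMatrix_mem {R : Set (V × V)} (hR : R ∈ C.relations) :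
    adjMatrix R ∈ C.adjacencyAlgebra :=
  Submodule.subset_span ⟨R, hR, rfl⟩

theorem conjTranspose_mem {M : Matrix V V ℂ} (hM : M ∈ C.adjacencyAlgebra) :
    M.conjTranspose ∈ C.adjacencyAlgebra := by
  rw [mem_adjacencyAlgebra_iff] at hM ⊢
  intro R hR p hp q hq
  simp only [Matrix.conjTranspose_apply]
  rw [hM _ (C.transpose_mem R hR) (p.2, p.1) hp (q.2, q.1) hq]

/-- The coordinates of an element of the adjacency algebra: its values on the basis relations. -/
noncomputable def coordinates : C.adjacencyAlgebra ≃ₗ[ℂ] (C.relations → ℂ) :=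
  LinearEquiv.ofBijective
    { toFun := fun (M : C.adjacencyAlgebra) R => (M : Matrix V V ℂ) (C.point R).1 (C.point R).2
      map_add' := fun _ _ => rfl
      map_smul' := fun _ _ => rfl } (by
    constructor
    · intro M N h
      apply Subtype.ext
      ext u v
      obtain ⟨R, hR, huv⟩ := C.exists_relation (u, v)
      have hM := C.mem_adjacencyAlgebra_iff.1 M.2 R hR _ huv _ (C.point_mem ⟨R, hR⟩)
      have hN := C.mem_adjacencyAlgebra_iff.1 N.2 R hR _ huv _ (C.point_mem ⟨R, hR⟩)
      exact hM.trans ((congrFun h ⟨R, hR⟩).trans hN.symm)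
    · intro c
      choose rel hrel hmem using C.exists_relation
      have hr : ∀ (R : C.relations) (p : V × V), p ∈ (R : Set (V × V)) → ⟨rel p, hrel p⟩ = R :=
        fun R p hp => Subtype.ext (C.relation_unique (hrel p) R.2 (hmem p) hp)
      refine ⟨⟨Matrix.of fun u v => c ⟨rel (u, v), hrel (u, v)⟩, ?_⟩, ?_⟩
      · rw [mem_adjacencyAlgebra_iff]
        intro R hR p hp q hq
        exact congrArg c ((hr ⟨R, hR⟩ p hp).trans (hr ⟨R, hR⟩ q hq).symm)
      · ext R
        exact congrArg c (hr R _ (C.point_mem R)))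

/-- The trace of `x ↦ M * x * N` on the adjacency algebra, computed in the basis of adjacency
matrices. -/
theorem trace_mulLeft_comp_mulRight [Fintype C.relations] (M N : C.adjacencyAlgebra) :
    LinearMap.trace ℂ _ (LinearMap.mulLeft ℂ M ∘ₗ LinearMap.mulRight ℂ N) =
      ∑ R : C.relations, ((M : Matrix V V ℂ) * adjMatrix (R : Set (V × V)) * N)
        (C.point R).1 (C.point R).2 := by
  classical
  have hb : ∀ R : C.relations, Module.Basis.ofEquivFun C.coordinates R =
      ⟨adjMatrix (R : Set (V × V)), C.adjMatrix_mem R.2⟩ := by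
    intro R
    rw [Module.Basis.coe_ofEquivFun, LinearEquiv.symm_apply_eq]
    ext S
    change _ = adjMatrix (R : Set (V × V)) (C.point S).1 (C.point S).2
    by_cases h : S = R
    · subst h
      simp [adjMatrix, C.point_mem S]
    · have : C.point S ∉ (R : Set (V × V)) := fun h' =>
        h (Subtype.ext (C.relation_unique S.2 R.2 (C.point_mem S) h'))
      simp [adjMatrix, this, h]
  rw [LinearMap.trace_eq_matrix_trace ℂ (Module.Basis.ofEquivFun C.coordinates), Matrix.trace]
  refine Finset.sum_congr rfl fun R _ => ?_
  rw [Matrix.diag_apply, LinearMap.toMatrix_apply, hb, Module.Basis.ofEquivFun_repr_apply]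
  change ((M : Matrix V V ℂ) * (adjMatrix (R : Set (V × V)) * N)) (C.point R).1 (C.point R).2 = _
  rw [Matrix.mul_assoc]

/-- The projection `M ↦ E_X * M * E_Y` of the adjacency algebra has as trace its rank, the number of
basis relations between `X` and `Y`. -/
theorem trace_fiber_fiber {X Y : Set V} (hX : X ∈ C.fibers) (hY : Y ∈ C.fibers) :
    LinearMap.trace ℂ C.adjacencyAlgebra
      (LinearMap.mulLeft ℂ ⟨_, C.adjMatrix_mem hX.2⟩ ∘ₗ
        LinearMap.mulRight ℂ ⟨_, C.adjMatrix_mem hY.2⟩) = (C.relationsBetween X Y).ncard := by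
  classical
  have := Fintype.ofFinite C.relations
  rw [trace_mulLeft_comp_mulRight]
  have h : ∀ R : C.relations, (adjMatrix {p : V × V | p.1 = p.2 ∧ p.1 ∈ X} *
      adjMatrix (R : Set (V × V)) * adjMatrix {p : V × V | p.1 = p.2 ∧ p.1 ∈ Y})
        (C.point R).1 (C.point R).2 = if (R : Set (V × V)) ⊆ X ×ˢ Y then 1 else 0 := by
    intro R
    rw [adjMatrix_diagonal, adjMatrix_diagonal, Matrix.mul_diagonal, Matrix.diagonal_mul]
    have h1 : (R : Set (V × V)) ⊆ X ×ˢ Y ↔ (C.point R).1 ∈ X ∧ (C.point R).2 ∈ Y :=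
      ⟨fun h => h (C.point_mem R), fun h => C.subset_prod_of_mem hX hY R.2 (C.point_mem R) h.1 h.2⟩
    simp only [h1, adjMatrix, Matrix.of_apply, Prod.mk.eta, C.point_mem R, if_true]
    split_ifs <;> simp_all
  rw [Finset.sum_congr rfl fun R _ => h R, Finset.sum_boole, Nat.cast_inj, ← Set.ncard_coe_finset,
    ← Set.ncard_image_of_injective _ Subtype.val_injective]
  congr 1
  ext R
  simp [relationsBetween, and_comm]

end Trace

/-! ### The averaging idempotents -/

section Average

variable {V : Type*}

/-- The matrix `|Y|⁻¹ J_Y`, the orthogonal projection onto the line spanned by the indicator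
vector of `Y`. -/
noncomputable def avgMatrix (Y : Set V) : Matrix V V ℂ :=
  (Y.ncard : ℂ)⁻¹ • adjMatrix (Y ×ˢ Y)

open Classical in
theorem avgMatrix_apply (Y : Set V) (u v : V) :
    avgMatrix Y u v = if u ∈ Y ∧ v ∈ Y then (Y.ncard : ℂ)⁻¹ else 0 := by
  simp [avgMatrix, adjMatrix]

variable [Fintype V]

open Classical in
theorem sum_adjMatrix (R : Set (V × V)) (u : V) :
    ∑ w, adjMatrix R u w = ({w | (u, w) ∈ R}.ncard : ℂ) := by
  simp only [adjMatrix, Matrix.of_apply, Finset.sum_boole, Nat.cast_inj]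
  rw [← Set.ncard_coe_finset]
  congr 1
  ext w
  simp

open Classical in
theorem sum_indicator (Y : Set V) (c : ℂ) : ∑ w, (if w ∈ Y then c else 0) = Y.ncard * c := by
  rw [← Finset.sum_filter, Finset.sum_const, nsmul_eq_mul, ← Set.ncard_coe_finset]
  simp

variable (C : CoherentConfiguration V)

theorem ncard_fiber_ne_zero {X : Set V} (hX : X ∈ C.fibers) : (X.ncard : ℂ) ≠ 0 :=
  Nat.cast_ne_zero.2 ((Set.ncard_pos (Set.toFinite _)).2 hX.1).ne'

theorem sum_avgMatrix {Y : Set V} (hY : Y ∈ C.fibers) {u : V} (hu : u ∈ Y) :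
    ∑ w, avgMatrix Y u w = 1 := by
  classical
  simp only [avgMatrix_apply, hu, true_and]
  rw [sum_indicator, mul_inv_cancel₀ (C.ncard_fiber_ne_zero hY)]

theorem trace_avgMatrix {Y : Set V} (hY : Y ∈ C.fibers) : (avgMatrix Y).trace = 1 := by
  classical
  simp only [Matrix.trace, Matrix.diag_apply, avgMatrix_apply, and_self]
  rw [sum_indicator, mul_inv_cancel₀ (C.ncard_fiber_ne_zero hY)]

theorem isIdempotentElem_avgMatrix {Y : Set V} (hY : Y ∈ C.fibers) :
    IsIdempotentElem (avgMatrix Y) := by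
  classical
  ext u v
  rw [Matrix.mul_apply]
  have h : ∀ w, avgMatrix Y u w * avgMatrix Y w v = avgMatrix Y u w * avgMatrix Y u v := by
    intro w
    simp only [avgMatrix_apply]
    split_ifs <;> simp_all
  rw [Finset.sum_congr rfl fun w _ => h w, ← Finset.sum_mul]
  by_cases hu : u ∈ Y
  · rw [C.sum_avgMatrix hY hu, one_mul]
  · simp [avgMatrix_apply, hu]

variable [DecidableEq V]

theorem avgMatrix_mem {Y : Set V} (hY : Y ∈ C.fibers) : avgMatrix Y ∈ C.adjacencyAlgebra := by
  classical
  rw [mem_adjacencyAlgebra_iff]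
  intro R hR p hp q hq
  have h : p.1 ∈ Y ∧ p.2 ∈ Y ↔ q.1 ∈ Y ∧ q.2 ∈ Y :=
    ⟨fun h => C.subset_prod_of_mem hY hY hR hp h.1 h.2 hq,
      fun h => C.subset_prod_of_mem hY hY hR hq h.1 h.2 hp⟩
  simp only [avgMatrix_apply, h]

/-- If `M` is supported on `X × X` with constant row sum `c`, then `M * A_S` multiplies the
indicator vector of `Y` by `c` times the valency of `S`, for `S ⊆ X × Y`; the valencies of these
`S` add up to `|Y|`. -/
theorem trace_mul_avgMatrix {X Y : Set V} (hX : X ∈ C.fibers) (hY : Y ∈ C.fibers)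
    (M : C.adjacencyAlgebra) (c : ℂ)
    (hl : ∀ u w, u ∉ X → (M : Matrix V V ℂ) u w = 0)
    (hr : ∀ u w, w ∉ X → (M : Matrix V V ℂ) u w = 0)
    (hc : ∀ u ∈ X, ∑ w, (M : Matrix V V ℂ) u w = c) :
    LinearMap.trace ℂ C.adjacencyAlgebra
      (LinearMap.mulLeft ℂ M ∘ₗ LinearMap.mulRight ℂ ⟨_, C.avgMatrix_mem hY⟩) = c := by
  classical
  have := Fintype.ofFinite C.relations
  obtain ⟨x, hx⟩ := hX.1
  rw [trace_mulLeft_comp_mulRight]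
  -- both sides vanish unless `S ⊆ X × Y`, and then the sum on the right is the valency of `S`
  have h : ∀ S : C.relations, ((M : Matrix V V ℂ) * adjMatrix (S : Set (V × V)) * avgMatrix Y)
        (C.point S).1 (C.point S).2 =
      c * (Y.ncard : ℂ)⁻¹ * ∑ z, if z ∈ Y then adjMatrix (S : Set (V × V)) x z else 0 := by
    intro S
    by_cases h2 : (C.point S).2 ∈ Y
    swap
    · have hz : ∀ z ∈ Y, (x, z) ∉ (S : Set (V × V)) := fun z hz hxz => h2
        (C.subset_prod_of_mem hX hY S.2 hxz hx hz (C.point_mem S)).2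
      rw [Finset.sum_eq_zero fun z _ => ?_, mul_zero, Matrix.mul_apply,
        Finset.sum_eq_zero fun z _ => ?_]
      · simp [avgMatrix_apply, h2]
      · split_ifs with hzY
        · simp [adjMatrix, hz z hzY]
        · rfl
    by_cases h1 : (C.point S).1 ∈ X
    swap
    · have hz : ∀ z ∈ Y, (x, z) ∉ (S : Set (V × V)) := fun z hz hxz => h1
        (C.subset_prod_of_mem hX hY S.2 hxz hx hz (C.point_mem S)).1
      rw [Finset.sum_eq_zero fun z _ => ?_, mul_zero, Matrix.mul_assoc, Matrix.mul_apply,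
        Finset.sum_eq_zero fun z _ => ?_]
      · simp [hl _ _ h1]
      · split_ifs with hzY
        · simp [adjMatrix, hz z hzY]
        · rfl
    have hS : (S : Set (V × V)) ∈ C.relationsBetween X Y :=
      ⟨S.2, C.subset_prod_of_mem hX hY S.2 (C.point_mem S) h1 h2⟩
    have hrow : ∀ w ∈ X, (∑ z, if z ∈ Y then adjMatrix (S : Set (V × V)) w z else 0) =
        ∑ z, if z ∈ Y then adjMatrix (S : Set (V × V)) x z else 0 := by
      have e : ∀ w, (∑ z, if z ∈ Y then adjMatrix (S : Set (V × V)) w z else 0) =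
          ∑ z, adjMatrix (S : Set (V × V)) w z := by
        refine fun w => Finset.sum_congr rfl fun z _ => ?_
        split_ifs with hz
        · rfl
        · have : (w, z) ∉ (S : Set (V × V)) := fun h => hz (hS.2 h).2
          simp [adjMatrix, this]
      intro w hw
      rw [e, e, sum_adjMatrix, sum_adjMatrix, C.ncard_out_eq hX hS hw hx]
    rw [Matrix.mul_assoc, Matrix.mul_apply, ← hc _ h1, Finset.sum_mul, Finset.sum_mul]
    refine Finset.sum_congr rfl fun w _ => ?_
    by_cases hw : w ∈ X
    · rw [← hrow w hw, mul_assoc]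
      congr 1
      rw [Matrix.mul_apply, Finset.mul_sum]
      refine Finset.sum_congr rfl fun z _ => ?_
      simp only [avgMatrix_apply, h2, and_true]
      split_ifs <;> ring
    · rw [hr _ _ hw, zero_mul, zero_mul, zero_mul]
  have h3 : ∀ z, ∑ S : C.relations, adjMatrix (S : Set (V × V)) x z = 1 := by
    intro z
    obtain ⟨R, hR, hz⟩ := C.exists_relation (x, z)
    rw [Finset.sum_eq_single ⟨R, hR⟩]
    · simp [adjMatrix, hz]
    · intro S _ hS
      have : (x, z) ∉ (S : Set (V × V)) := fun h =>
        hS (Subtype.ext (C.relation_unique S.2 hR h hz))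
      simp [adjMatrix, this]
    · simp
  have h4 : ∀ z, (∑ S : C.relations, if z ∈ Y then adjMatrix (S : Set (V × V)) x z else 0) =
      if z ∈ Y then 1 else 0 := by
    intro z
    split_ifs
    · exact h3 z
    · simp
  rw [Finset.sum_congr rfl fun S _ => h S, ← Finset.mul_sum, Finset.sum_comm,
    Finset.sum_congr rfl fun z _ => h4 z, sum_indicator, mul_one, mul_assoc,
    inv_mul_cancel₀ (C.ncard_fiber_ne_zero hY), mul_one]

end Average

/-! ### Multiplicities of the fibers in the simple components -/

section Multiplicities

variable {V : Type*} [Fintype V] [DecidableEq V] (C : CoherentConfiguration V)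

/-- The idempotent of the adjacency algebra given by a fiber. -/
noncomputable def fiberIdempotent (X : C.fibers) : C.adjacencyAlgebra :=
  ⟨_, C.adjMatrix_mem X.2.2⟩

/-- The idempotent `|X|⁻¹ J_X` of the adjacency algebra. -/
noncomputable def avgIdempotent (X : C.fibers) : C.adjacencyAlgebra :=
  ⟨_, C.avgMatrix_mem X.2⟩

theorem isIdempotentElem_fiberIdempotent (X : C.fibers) :
    IsIdempotentElem (C.fiberIdempotent X) := by
  classical
  apply Subtype.ext
  simp only [fiberIdempotent, adjMatrix_diagonal, MulMemClass.mk_mul_mk,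
    Matrix.diagonal_mul_diagonal]
  simp

theorem isIdempotentElem_avgIdempotent (X : C.fibers) :
    IsIdempotentElem (C.avgIdempotent X) :=
  Subtype.ext (C.isIdempotentElem_avgMatrix X.2)

theorem sum_fiberIdempotent [Fintype C.fibers] : ∑ X, C.fiberIdempotent X = 1 := by
  classical
  apply Subtype.ext
  ext u v
  rw [AddSubmonoidClass.coe_finsetSum, Matrix.sum_apply]
  simp only [fiberIdempotent, adjMatrix_diagonal, Matrix.diagonal_apply]
  change _ = (1 : Matrix V V ℂ) u v
  by_cases h : u = v
  · subst h
    obtain ⟨X, hX, hu⟩ := C.exists_fiber u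
    rw [Finset.sum_eq_single ⟨X, hX⟩]
    · simp [hu]
    · intro Y _ hY
      have : u ∉ (Y : Set V) := fun h => hY (Subtype.ext (C.fiber_unique Y.2 hX h hu))
      simp [this]
    · simp
  · simp [h]

variable {ι : Type*} [Fintype ι] [DecidableEq ι] {d : ι → ℕ}
  (φ : C.adjacencyAlgebra ≃ₐ[ℂ] Π i, Matrix (Fin (d i)) (Fin (d i)) ℂ)

/-- The pairing `∑ i, tr Mᵢ * tr Nᵢ` does not depend on the Wedderburn decomposition `φ`, and so it
can be read off from the basis relations. -/
theorem sum_trace_mul_trace (M N : C.adjacencyAlgebra) :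
    ∑ i, (φ M i).trace * (φ N i).trace =
      LinearMap.trace ℂ _ (LinearMap.mulLeft ℂ M ∘ₗ LinearMap.mulRight ℂ N) := by
  rw [← trace_mulLeft_comp_mulRight_pi, ← LinearMap.trace_conj' _ φ.toLinearEquiv]
  congr 1
  refine LinearMap.ext fun x => ?_
  simp [LinearEquiv.conj_apply]

theorem sum_trace_avgIdempotent (X Y : C.fibers) :
    ∑ i, (φ (C.avgIdempotent X) i).trace * (φ (C.avgIdempotent Y) i).trace = 1 := by
  classical
  rw [sum_trace_mul_trace]
  refine C.trace_mul_avgMatrix X.2 Y.2 _ _ ?_ ?_ fun u hu => C.sum_avgMatrix X.2 hu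
  · intro u w hu
    simp [avgIdempotent, avgMatrix_apply, hu]
  · intro u w hu
    simp [avgIdempotent, avgMatrix_apply, hu]

theorem sum_trace_adjMatrix_avgIdempotent (X Y : C.fibers) {R : Set (V × V)}
    (hR : R ∈ C.relationsBetween X X) {x : V} (hx : x ∈ (X : Set V)) :
    ∑ i, (φ ⟨_, C.adjMatrix_mem hR.1⟩ i).trace * (φ (C.avgIdempotent Y) i).trace =
      {w | (x, w) ∈ R}.ncard := by
  classical
  rw [sum_trace_mul_trace]
  refine C.trace_mul_avgMatrix X.2 Y.2 _ _ ?_ ?_ fun u hu => ?_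
  · intro u w hu
    have : (u, w) ∉ R := fun h => hu (hR.2 h).1
    simp [adjMatrix, this]
  · intro u w hu
    have : (u, w) ∉ R := fun h => hu (hR.2 h).2
    simp [adjMatrix, this]
  · rw [sum_adjMatrix, C.ncard_out_eq X.2 hR hu hx]

/-- The matrices `|X|⁻¹ J_X` have rank one and lie in a single simple component, the same one for
all fibers `X`. -/
theorem exists_principal [Nonempty V] : ∃ i₀, ∀ (X : C.fibers) i,
    (φ (C.avgIdempotent X) i).trace = if i = i₀ then 1 else 0 := by
  classical
  have h : ∀ i (X : C.fibers), ∃ n : ℕ, (φ (C.avgIdempotent X) i).trace = n := fun i X =>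
    Matrix.exists_natCast_eq_trace (congrFun ((C.isIdempotentElem_avgIdempotent X).map φ) i)
  choose n hn using h
  have hsum : ∀ X Y, ∑ i, n i X * n i Y = 1 := by
    intro X Y
    have := C.sum_trace_avgIdempotent φ X Y
    simp only [hn] at this
    exact_mod_cast this
  obtain ⟨X, hX, -⟩ := C.exists_fiber (Classical.arbitrary V)
  obtain ⟨i₀, h1⟩ := (Finsupp.sum_eq_one_iff
    (Finsupp.equivFunOnFinite.symm fun i => n i ⟨X, hX⟩ * n i ⟨X, hX⟩)).1 (by
      rw [Finsupp.sum_fintype _ _ fun _ => rfl]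
      exact hsum ⟨X, hX⟩ ⟨X, hX⟩)
  have h2 : ∀ i, n i ⟨X, hX⟩ * n i ⟨X, hX⟩ = if i = i₀ then 1 else 0 := fun i => by
    simpa [Finsupp.single_apply, eq_comm] using DFunLike.congr_fun h1 i
  refine ⟨i₀, fun Y i => ?_⟩
  rw [hn, eq_of_sum_mul_eq hsum Y ⟨X, hX⟩]
  have h3 := h2 i
  split_ifs at h3 ⊢ with hi
  · rw [(mul_eq_one.1 h3).1, Nat.cast_one]
  · rw [mul_self_eq_zero.1 h3, Nat.cast_zero]

end Multiplicities

section Multiplicities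

variable {V : Type*} [Fintype V] [DecidableEq V] (C : CoherentConfiguration V)

theorem isIntegral_adjMatrix (R : Set (V × V)) : IsIntegral ℤ (adjMatrix R) := by
  classical
  let N : Matrix V V ℤ := Matrix.of fun u v => if (u, v) ∈ R then 1 else 0
  have h : IsIntegral ℤ N := Matrix.isIntegral N
  have h2 : (Int.castRingHom ℂ).mapMatrix N = adjMatrix R := by
    ext u v
    by_cases huv : (u, v) ∈ R <;> simp [N, adjMatrix, huv]
  rw [← h2]
  exact h.map ((Int.castRingHom ℂ).mapMatrix (m := V)).toIntAlgHom

variable {ι : Type*} {d : ι → ℕ}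
  (φ : C.adjacencyAlgebra ≃ₐ[ℂ] Π i, Matrix (Fin (d i)) (Fin (d i)) ℂ)

theorem isIntegral_trace_adjMatrix {R : Set (V × V)} (hR : R ∈ C.relations) (i : ι) :
    IsIntegral ℤ (φ ⟨_, C.adjMatrix_mem hR⟩ i).trace := by
  apply Matrix.isIntegral_trace
  have h1 : IsIntegral ℤ (⟨_, C.adjMatrix_mem hR⟩ : C.adjacencyAlgebra) :=
    (isIntegral_algHom_iff (C.adjacencyAlgebra.val.toRingHom.toIntAlgHom)
      Subtype.val_injective).1 (isIntegral_adjMatrix R)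
  exact h1.map ((Pi.evalRingHom (fun i => Matrix (Fin (d i)) (Fin (d i)) ℂ) i).comp
    φ.toRingEquiv.toRingHom).toIntAlgHom

variable [Fintype ι] [DecidableEq ι]

/-- The character of the principal component maps the adjacency matrix of a basis relation to its
valency. -/
theorem trace_principal_adjMatrix {i₀ : ι} (h₀ : ∀ (X : C.fibers) i,
    (φ (C.avgIdempotent X) i).trace = if i = i₀ then 1 else 0) (X : C.fibers) {R : Set (V × V)}
    (hR : R ∈ C.relationsBetween X X) {x : V} (hx : x ∈ (X : Set V)) :
    (φ ⟨_, C.adjMatrix_mem hR.1⟩ i₀).trace = {w | (x, w) ∈ R}.ncard := by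
  rw [← C.sum_trace_adjMatrix_avgIdempotent φ X X hR hx]
  simp [h₀]

theorem trace_principal_fiberIdempotent {i₀ : ι} (h₀ : ∀ (X : C.fibers) i,
    (φ (C.avgIdempotent X) i).trace = if i = i₀ then 1 else 0) (X : C.fibers) :
    (φ (C.fiberIdempotent X) i₀).trace = 1 := by
  obtain ⟨x, hx⟩ := X.2.1
  have h := C.trace_principal_adjMatrix φ h₀ X (C.diagonal_mem_relationsBetween X.2) hx
  have h1 : {w | (x, w) ∈ {p : V × V | p.1 = p.2 ∧ p.1 ∈ (X : Set V)}} = {x} := by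
    ext w
    simp [hx, eq_comm]
  rw [h1, Set.ncard_singleton, Nat.cast_one] at h
  exact h

/-- If there are only two simple components, then the multiplicity `n` of a fiber `X` in the
nonprincipal one is at most `1`. The standard trace is `tr₀ + m * tr₁`, it is `|X|` on `E_X` and
`0` on `A_R` for `R ⊆ X × X` off the diagonal, so `m * n = |X| - 1` and `m * tr₁ A_R = -n_R`.
As `tr₁ A_R` is a rational algebraic integer, `|X| - 1` divides `n * n_R`; adding up over the
`n ^ 2` relations `R` gives `n ^ 2 * (|X| - 1) ≤ n * (|X| - 1)`. -/
theorem multiplicity_le_one {i₀ i₁ : ι} (h₀ : ∀ (X : C.fibers) i,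
    (φ (C.avgIdempotent X) i).trace = if i = i₀ then 1 else 0) (h01 : i₀ ≠ i₁)
    (huniv : (Finset.univ : Finset ι) = {i₀, i₁}) (X : C.fibers) {n : ℕ}
    (hn : (φ (C.fiberIdempotent X) i₁).trace = n) : n ≤ 1 := by
  classical
  by_contra! hlt
  have hn0 : (n : ℂ) ≠ 0 := Nat.cast_ne_zero.2 (by omega)
  obtain ⟨x, hx⟩ := X.2.1
  have hE := C.trace_principal_fiberIdempotent φ h₀ X
  obtain ⟨m, hm⟩ := exists_tracial_eq_sum (Matrix.traceLinearMap V ℂ ℂ ∘ₗ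
    C.adjacencyAlgebra.val.toLinearMap ∘ₗ φ.symm.toLinearMap) fun x y => by
      simpa using Matrix.trace_mul_comm (φ.symm x : Matrix V V ℂ) (φ.symm y)
  have hT : ∀ M : C.adjacencyAlgebra, (M : Matrix V V ℂ).trace =
      m i₀ * (φ M i₀).trace + m i₁ * (φ M i₁).trace := by
    intro M
    have := hm (φ M)
    rw [huniv, Finset.sum_pair h01] at this
    simpa using this
  have hm0 : m i₀ = 1 := by
    have := hT (C.avgIdempotent X)
    rw [h₀, h₀, if_pos rfl, if_neg h01.symm] at this
    simpa [avgIdempotent, C.trace_avgMatrix X.2] using this.symm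
  have hX : ((X : Set V).ncard : ℂ) = 1 + m i₁ * n := by
    have := hT (C.fiberIdempotent X)
    rw [hE, hn, hm0, mul_one] at this
    rw [← this]
    change _ = (adjMatrix _).trace
    rw [adjMatrix_diagonal, Matrix.trace_diagonal, sum_indicator, mul_one]
  -- each nondiagonal relation has valency at least `(|X| - 1) / n`
  have hval : ∀ R ∈ C.relationsBetween X X, R ≠ {p : V × V | p.1 = p.2 ∧ p.1 ∈ (X : Set V)} →
      (X : Set V).ncard ≤ n * {w | (x, w) ∈ R}.ncard + 1 ∧ 1 < (X : Set V).ncard := by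
    intro R hR hne
    have hoff : ∀ v, (v, v) ∉ R := fun v hv =>
      hne (C.relation_unique hR.1 X.2.2 hv ⟨rfl, (hR.2 hv).1⟩)
    have h1 := hT ⟨_, C.adjMatrix_mem hR.1⟩
    rw [hm0, one_mul, C.trace_principal_adjMatrix φ h₀ X hR hx] at h1
    have h2 : (adjMatrix R).trace = 0 := by simp [Matrix.trace, adjMatrix, hoff]
    have hint := C.isIntegral_trace_adjMatrix φ hR.1 i₁
    set t := (φ ⟨_, C.adjMatrix_mem hR.1⟩ i₁).trace
    have h3 : ({w | (x, w) ∈ R}.ncard : ℂ) + m i₁ * t = 0 := h1.symm.trans h2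
    have hpos : 0 < {w | (x, w) ∈ R}.ncard := by
      obtain ⟨⟨a, b⟩, hab⟩ := C.relation_nonempty hR.1
      rw [C.ncard_out_eq X.2 hR hx (hR.2 hab).1, Set.ncard_pos (Set.toFinite _)]
      exact ⟨b, hab⟩
    set N := (X : Set V).ncard
    set v := {w | (x, w) ∈ R}.ncard
    have h4 : (n : ℂ) * v = -(((N : ℂ) - 1) * t) := by
      rw [hX]
      linear_combination (n : ℂ) * h3
    have hN0 : (N : ℂ) - 1 ≠ 0 := by
      intro h
      rw [h, zero_mul, neg_zero] at h4
      have := (mul_eq_zero.1 h4).resolve_left hn0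
      exact hpos.ne' (by exact_mod_cast this)
    have ht : t = algebraMap ℚ ℂ (-((n : ℚ) * v / ((N : ℚ) - 1))) := by
      simp only [map_neg, map_div₀, map_mul, map_sub, map_natCast, map_one]
      field_simp
      linear_combination h4
    rw [ht, isIntegral_algebraMap_iff (algebraMap ℚ ℂ).injective,
      IsIntegrallyClosed.isIntegral_iff] at hint
    obtain ⟨z, hz⟩ := hint
    rw [← hz] at ht
    have h5 : (n : ℤ) * v = ((N : ℤ) - 1) * (-z) := by
      have : (n : ℂ) * v = ((N : ℂ) - 1) * (-(z : ℂ)) := by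
        rw [h4, ht]
        simp
      exact_mod_cast this
    have hN1 : 1 < N := by
      have h6 : 0 < N := (Set.ncard_pos (Set.toFinite _)).2 ⟨x, hx⟩
      have h7 : N ≠ 1 := fun h => hN0 (by simp [h])
      omega
    refine ⟨?_, hN1⟩
    have h8 : (0 : ℤ) < (n : ℤ) * v := by positivity
    have h9 : 0 < -z := by
      rw [h5] at h8
      exact pos_of_mul_pos_right h8 (by omega)
    have h10 : ((N : ℤ) - 1) * 1 ≤ ((N : ℤ) - 1) * (-z) :=
      mul_le_mul_of_nonneg_left (by omega) (by omega)
    rw [← h5] at h10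
    zify
    linarith
  have hcount : (C.relationsBetween X X).ncard = 1 + n * n := by
    have h1 := C.sum_trace_mul_trace φ (C.fiberIdempotent X) (C.fiberIdempotent X)
    rw [huniv, Finset.sum_pair h01, hE, hn, fiberIdempotent, C.trace_fiber_fiber X.2 X.2] at h1
    have h2 : ((C.relationsBetween X X).ncard : ℂ) = ((1 + n * n : ℕ) : ℂ) := by
      rw [← h1]; push_cast; ring
    exact_mod_cast h2
  have hsum := C.sum_ncard_out X.2 hx
  set T := (Set.toFinite (C.relationsBetween X X)).toFinset with hTdef
  have hD : {p : V × V | p.1 = p.2 ∧ p.1 ∈ (X : Set V)} ∈ T := by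
    simpa [T] using C.diagonal_mem_relationsBetween X.2
  have hcard : T.card = 1 + n * n := by
    rw [← hcount, ← Set.ncard_coe_finset, Set.Finite.coe_toFinset]
  have h1 : {w | (x, w) ∈ {p : V × V | p.1 = p.2 ∧ p.1 ∈ (X : Set V)}} = {x} := by
    ext w
    simp [hx, eq_comm]
  rw [← Finset.add_sum_erase _ _ hD, h1, Set.ncard_singleton] at hsum
  have hcard' : (T.erase {p : V × V | p.1 = p.2 ∧ p.1 ∈ (X : Set V)}).card = n * n := by
    rw [Finset.card_erase_of_mem hD, hcard]; omega
  have hval' : ∀ R ∈ T.erase {p : V × V | p.1 = p.2 ∧ p.1 ∈ (X : Set V)},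
      (X : Set V).ncard ≤ n * {w | (x, w) ∈ R}.ncard + 1 ∧ 1 < (X : Set V).ncard := fun R hR =>
    hval R (by simpa [T] using (Finset.mem_erase.1 hR).2) (Finset.mem_erase.1 hR).1
  have hne : (T.erase {p : V × V | p.1 = p.2 ∧ p.1 ∈ (X : Set V)}).Nonempty := by
    rw [← Finset.card_pos, hcard']; positivity
  obtain ⟨R, hR⟩ := hne
  have hN := (hval' R hR).2
  have hle := Finset.card_nsmul_le_sum _ (fun R => n * {w | (x, w) ∈ R}.ncard)
    ((X : Set V).ncard - 1) fun R hR => Nat.sub_le_iff_le_add.2 (hval' R hR).1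
  rw [hcard', ← Finset.mul_sum, smul_eq_mul, mul_assoc] at hle
  have hle' := Nat.le_of_mul_le_mul_left hle (by omega)
  have h3 : 2 * ((X : Set V).ncard - 1) ≤ n * ((X : Set V).ncard - 1) :=
    Nat.mul_le_mul_right _ hlt
  omega

/-- The number `k` of central primitive idempotents, with the multiplicities `n i X` of the fibers
`X` in the simple components `i` of the adjacency algebra; `i₀` is the principal component, which
contains the matrices `|X|⁻¹ J_X`. -/
theorem exists_multiplicities [Nonempty V] :
    ∃ (k : ℕ) (i₀ : Fin k) (n : Fin k → C.fibers → ℕ),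
      C.centralPrimitiveIdempotents.ncard = k ∧
      (∀ X Y, ∑ i, n i X * n i Y = (C.relationsBetween X Y).ncard) ∧
      (∀ i, ∃ X, n i X ≠ 0) ∧ (∀ X, n i₀ X = 1) ∧ (k = 2 → ∀ i X, n i X ≤ 1) := by
  classical
  have := C.adjacencyAlgebra.isSemisimpleRing_of_conjTranspose_mem fun _ => C.conjTranspose_mem
  obtain ⟨k, d, hd, ⟨φ⟩⟩ :=
    IsSemisimpleRing.exists_algEquiv_pi_matrix_of_isAlgClosed ℂ C.adjacencyAlgebra
  obtain ⟨i₀, h₀⟩ := C.exists_principal φ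
  have h : ∀ i (X : C.fibers), ∃ n : ℕ, (φ (C.fiberIdempotent X) i).trace = n := fun i X =>
    Matrix.exists_natCast_eq_trace (congrFun ((C.isIdempotentElem_fiberIdempotent X).map φ) i)
  choose n hn using h
  have hn0 : ∀ X, n i₀ X = 1 := by
    intro X
    have := C.trace_principal_fiberIdempotent φ h₀ X
    rw [hn] at this
    exact_mod_cast this
  refine ⟨k, i₀, n, ?_, fun X Y => ?_, fun i => ?_, hn0, fun hk i X => ?_⟩
  · rw [centralPrimitiveIdempotents, ncard_isCentralPrimitiveIdempotent (fun i => (hd i).out) φ,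
      Fintype.card_fin]
  · have := C.sum_trace_mul_trace φ (C.fiberIdempotent X) (C.fiberIdempotent Y)
    rw [fiberIdempotent, fiberIdempotent, C.trace_fiber_fiber X.2 Y.2] at this
    change ∑ i, (φ (C.fiberIdempotent X) i).trace * (φ (C.fiberIdempotent Y) i).trace = _ at this
    simp only [hn] at this
    exact_mod_cast this
  · by_contra! hX
    have := Fintype.ofFinite C.fibers
    have h1 : (φ (∑ X, C.fiberIdempotent X) i).trace = 0 := by
      simp [map_sum, Finset.sum_apply, Matrix.trace_sum, hn, hX]
    rw [sum_fiberIdempotent, map_one, Pi.one_apply, Matrix.trace_one, Fintype.card_fin] at h1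
    exact (hd i).out (by exact_mod_cast h1)
  · by_cases hi : i = i₀
    · rw [hi, hn0]
    · refine C.multiplicity_le_one φ h₀ (Ne.symm hi) ?_ X (hn i X)
      refine (Finset.eq_univ_of_card _ ?_).symm
      rw [Finset.card_pair (Ne.symm hi), Fintype.card_fin, hk]

end Multiplicities

/-! ### Balanced configurations -/

section Balanced

variable {V : Type*} [Finite V] (C : CoherentConfiguration V)

theorem isBalanced_one_iff_isTrivial : C.IsBalanced 1 ↔ C.IsTrivial := by
  constructor
  · intro h X hX
    obtain ⟨x, hx⟩ := hX.1
    refine ⟨x, Set.eq_singleton_iff_unique_mem.2 ⟨hx, fun y hy => ?_⟩⟩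
    obtain ⟨S, hS⟩ := Set.ncard_eq_one.1 (h X hX X hX)
    obtain ⟨R, hR, hxy⟩ := C.exists_relation (x, y)
    have h1 : R ∈ C.relationsBetween X X := ⟨hR, C.subset_prod_of_mem hX hX hR hxy hx hy⟩
    have h2 := C.diagonal_mem_relationsBetween hX
    rw [hS, Set.mem_singleton_iff] at h1 h2
    rw [h1, ← h2] at hxy
    exact hxy.1.symm
  · intro h X hX Y hY
    obtain ⟨x, hx⟩ := h X hX
    obtain ⟨y, hy⟩ := h Y hY
    obtain ⟨R, hR, hxy⟩ := C.exists_relation (x, y)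
    refine Set.ncard_eq_one.2 ⟨R, Set.eq_singleton_iff_unique_mem.2 ⟨⟨hR,
      C.subset_prod_of_mem hX hY hR hxy (by simp [hx]) (by simp [hy])⟩, fun S hS => ?_⟩⟩
    obtain ⟨p, hp⟩ := C.relation_nonempty hS.1
    have hp' := hS.2 hp
    rw [hx, hy, Set.singleton_prod_singleton, Set.mem_singleton_iff] at hp'
    exact C.relation_unique hS.1 hR (hp' ▸ hp) hxy

theorem exists_fiber_subset {U : Set V} (hU : U ∈ C.fiberUnions) : ∃ X ∈ C.fibers, X ⊆ U := by
  obtain ⟨⟨u, hu⟩, F, hF, rfl⟩ := hU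
  obtain ⟨X, hX, -⟩ := hu
  exact ⟨X, hF hX, Set.subset_sUnion_of_mem hX⟩

theorem fiber_subset_of_mem {U : Set V} (hU : U ∈ C.fiberUnions) {X : Set V} (hX : X ∈ C.fibers)
    {x : V} (hx : x ∈ X) (hxU : x ∈ U) : X ⊆ U := by
  obtain ⟨-, F, hF, rfl⟩ := hU
  obtain ⟨Y, hY, hxY⟩ := hxU
  rw [C.fiber_unique hX (hF hY) hx hxY]
  exact Set.subset_sUnion_of_mem hY

/-- Fiber multiplicities `a X ∈ {0, 1}` with `|R_{X,Y}| = 1 + a X * a Y`, not all zero, split the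
configuration into a `1`-balanced part (`a = 0`) and a `2`-balanced part (`a = 1`). -/
theorem isBalanced_two_or_directSum (a : C.fibers → ℕ) (ha : ∀ X, a X ≤ 1) (hne : ∃ X, a X ≠ 0)
    (hcount : ∀ X Y : C.fibers, (C.relationsBetween X Y).ncard = 1 + a X * a Y) :
    C.IsBalanced 2 ∨
      ∃ (U₁ U₂ : Set V) (h : C.IsInternalDirectSum U₁ U₂),
        (C.restrict U₁ h.left_mem).IsBalanced 1 ∧ (C.restrict U₂ h.right_mem).IsBalanced 2 := by
  by_cases hz : ∃ X, a X = 0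
  swap
  · left
    push Not at hz
    have h1 : ∀ X, a X = 1 := fun X => by have := ha X; have := hz X; omega
    intro X hX Y hY
    rw [hcount ⟨X, hX⟩ ⟨Y, hY⟩, h1, h1]
  right
  have hU : ∀ c, (∃ X, a X = c) → (⋃₀ (Subtype.val '' {X | a X = c})) ∈ C.fiberUnions := by
    rintro c ⟨X, hX⟩
    refine ⟨?_, _, ?_, rfl⟩
    · obtain ⟨x, hx⟩ := X.2.1
      exact ⟨x, X, ⟨X, hX, rfl⟩, hx⟩
    · rintro _ ⟨X, -, rfl⟩
      exact X.2
  have hval : ∀ c (X : C.fibers) x, x ∈ (X : Set V) →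
      x ∈ ⋃₀ (Subtype.val '' {X | a X = c}) → a X = c := by
    rintro c X x hx ⟨_, ⟨Y, hY, rfl⟩, hxY⟩
    rw [Subtype.ext (C.fiber_unique X.2 Y.2 hx hxY)]
    exact hY
  have hval' : ∀ c X (hX : X ∈ C.fibers), X ⊆ ⋃₀ (Subtype.val '' {X | a X = c}) →
      a ⟨X, hX⟩ = c := by
    intro c X hX hXU
    obtain ⟨x, hx⟩ := hX.1
    exact hval c ⟨X, hX⟩ x hx (hXU hx)
  have hz1 : ∃ X, a X = 1 := by
    obtain ⟨X, hX⟩ := hne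
    exact ⟨X, by have := ha X; omega⟩
  refine ⟨⋃₀ (Subtype.val '' {X | a X = 0}), ⋃₀ (Subtype.val '' {X | a X = 1}),
    ⟨hU 0 hz, hU 1 hz1, ?_, ?_, ?_⟩, ?_, ?_⟩
  · rw [Set.eq_empty_iff_forall_notMem]
    rintro x ⟨h0, h1⟩
    obtain ⟨X, hX, hx⟩ := C.exists_fiber x
    have e0 := hval 0 ⟨X, hX⟩ x hx h0
    have e1 := hval 1 ⟨X, hX⟩ x hx h1
    omega
  · rw [Set.eq_univ_iff_forall]
    intro x
    obtain ⟨X, hX, hx⟩ := C.exists_fiber x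
    have := ha ⟨X, hX⟩
    rcases Nat.le_one_iff_eq_zero_or_eq_one.1 this with h | h
    · exact Or.inl ⟨X, ⟨⟨X, hX⟩, h, rfl⟩, hx⟩
    · exact Or.inr ⟨X, ⟨⟨X, hX⟩, h, rfl⟩, hx⟩
  · intro X hX Y hY hXU hYU
    rw [hcount ⟨X, hX⟩ ⟨Y, hY⟩, hval' 0 X hX hXU, zero_mul, add_zero]
  · rw [isBalanced_restrict_iff]
    intro X hX Y hY hXU hYU
    rw [hcount ⟨X, hX⟩ ⟨Y, hY⟩, hval' 0 X hX hXU, zero_mul, add_zero]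
  · rw [isBalanced_restrict_iff]
    intro X hX Y hY hXU hYU
    rw [hcount ⟨X, hX⟩ ⟨Y, hY⟩, hval' 1 X hX hXU, hval' 1 Y hY hYU]

/-- In a direct sum of a `1`-balanced and a `2`-balanced part the multiplicity vectors of the
fibers take two values, with Gram matrix `!![1, 1; 1, 2]`; hence there are two components. -/
theorem card_eq_two_of_directSum {ι : Type*} [Fintype ι] (n : ι → C.fibers → ℕ)
    (hn : ∀ X Y, ∑ i, n i X * n i Y = (C.relationsBetween X Y).ncard)
    (hpos : ∀ i, ∃ X, n i X ≠ 0) {U₁ U₂ : Set V} (h : C.IsInternalDirectSum U₁ U₂)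
    (h1 : (C.restrict U₁ h.left_mem).IsBalanced 1) (h2 : (C.restrict U₂ h.right_mem).IsBalanced 2) :
    Fintype.card ι = 2 := by
  rw [isBalanced_restrict_iff] at h1 h2
  obtain ⟨X, hX, hXU⟩ := C.exists_fiber_subset h.left_mem
  obtain ⟨Y, hY, hYU⟩ := C.exists_fiber_subset h.right_mem
  have hXX : ∑ i, n i ⟨X, hX⟩ * n i ⟨X, hX⟩ = 1 := (hn _ _).trans (h1 X hX X hX hXU hXU)
  have hYY : ∑ i, n i ⟨Y, hY⟩ * n i ⟨Y, hY⟩ = 2 := (hn _ _).trans (h2 Y hY Y hY hYU hYU)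
  have hXY : ∑ i, n i ⟨X, hX⟩ * n i ⟨Y, hY⟩ = 1 :=
    (hn _ _).trans (h.one_relation X hX Y hY hXU hYU)
  have hor : ∀ i, n i ⟨X, hX⟩ ≠ 0 ∨ n i ⟨Y, hY⟩ ≠ 0 := by
    intro i
    obtain ⟨Z, hZ⟩ := hpos i
    obtain ⟨z, hz⟩ := Z.2.1
    have hzU : z ∈ U₁ ∪ U₂ := h.cover ▸ Set.mem_univ z
    refine hzU.imp (fun hzU => ?_) fun hzU => ?_
    · have hZU := C.fiber_subset_of_mem h.left_mem Z.2 hz hzU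
      have := eq_of_sum_mul_eq (n := fun i (W : {W : C.fibers // (W : Set V) ⊆ U₁}) => n i W)
        (r := 1) (fun W W' => (hn _ _).trans (h1 _ W.1.2 _ W'.1.2 W.2 W'.2))
        ⟨Z, hZU⟩ ⟨⟨X, hX⟩, hXU⟩ i
      exact this ▸ hZ
    · have hZU := C.fiber_subset_of_mem h.right_mem Z.2 hz hzU
      have := eq_of_sum_mul_eq (n := fun i (W : {W : C.fibers // (W : Set V) ⊆ U₂}) => n i W)
        (r := 2) (fun W W' => (hn _ _).trans (h2 _ W.1.2 _ W'.1.2 W.2 W'.2))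
        ⟨Z, hZU⟩ ⟨⟨Y, hY⟩, hYU⟩ i
      exact this ▸ hZ
  have hle : ∀ Z : C.fibers, ∑ i, n i Z * n i Z ≤ 2 → ∀ i, n i Z ≤ 1 := by
    intro Z hZ i
    have := (Finset.single_le_sum (f := fun i => n i Z * n i Z) (fun _ _ => Nat.zero_le _)
      (Finset.mem_univ i)).trans hZ
    by_contra! hc
    have : 2 * 2 ≤ n i Z * n i Z := Nat.mul_le_mul hc hc
    omega
  -- `x ^ 2 + y ^ 2 = 1 + x * y` for `x, y ∈ {0, 1}` not both zero
  have hone : ∀ i, n i ⟨X, hX⟩ * n i ⟨X, hX⟩ + n i ⟨Y, hY⟩ * n i ⟨Y, hY⟩ =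
      1 + n i ⟨X, hX⟩ * n i ⟨Y, hY⟩ := by
    intro i
    have a1 := hle ⟨X, hX⟩ (by omega) i
    have a2 := hle ⟨Y, hY⟩ (by omega) i
    have a3 := hor i
    generalize n i ⟨X, hX⟩ = x at *
    generalize n i ⟨Y, hY⟩ = y at *
    interval_cases x <;> interval_cases y <;> simp_all
  have hs := Finset.sum_congr (rfl : (Finset.univ : Finset ι) = _) fun i _ => hone i
  rw [Finset.sum_add_distrib, Finset.sum_add_distrib, hXX, hYY, hXY, Finset.sum_const,
    Finset.card_univ, smul_eq_mul] at hs
  omega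

end Balanced

end CoherentConfiguration

theorem theorem2 {V : Type*} [Fintype V] [DecidableEq V] [Nonempty V]
    (C : CoherentConfiguration V) :
    ((C.centralPrimitiveIdempotents.ncard = 1 ↔ C.IsBalanced 1) ∧
      (C.IsBalanced 1 ↔ C.IsTrivial)) ∧
    (C.centralPrimitiveIdempotents.ncard = 2 ↔
      C.IsBalanced 2 ∨
      ∃ (U₁ U₂ : Set V) (h : C.IsInternalDirectSum U₁ U₂),
        (C.restrict U₁ h.left_mem).IsBalanced 1 ∧ (C.restrict U₂ h.right_mem).IsBalanced 2) := by
  obtain ⟨k, i₀, n, hk, hsum, hpos, hprin, htwo⟩ := C.exists_multiplicities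
  have : Nonempty C.fibers := by
    obtain ⟨X, hX, -⟩ := C.exists_fiber (Classical.arbitrary V)
    exact ⟨⟨X, hX⟩⟩
  have hbal : ∀ r ≤ 3, C.IsBalanced r → k = r := by
    intro r hr h
    rw [← Fintype.card_fin k]
    exact card_eq_of_sum_mul_eq (fun X Y => (hsum X Y).trans (h X X.2 Y Y.2)) hr hpos
  rw [hk]
  refine ⟨⟨⟨fun h1 => ?_, hbal 1 (by norm_num)⟩, C.isBalanced_one_iff_isTrivial⟩, fun h2 => ?_, ?_⟩
  · subst h1
    intro X hX Y hY
    rw [← hsum ⟨X, hX⟩ ⟨Y, hY⟩, Fintype.sum_eq_single i₀ fun i hi =>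
      absurd (Subsingleton.elim i i₀) hi, hprin, hprin]
  · subst h2
    obtain ⟨i₁, h01, huniv⟩ : ∃ i₁, i₀ ≠ i₁ ∧ (Finset.univ : Finset (Fin 2)) = {i₀, i₁} := by
      have : ∀ i : Fin 2, ∃ j, i ≠ j ∧ (Finset.univ : Finset (Fin 2)) = {i, j} := by decide
      exact this i₀
    refine C.isBalanced_two_or_directSum (n i₁) (htwo rfl i₁) (hpos i₁) fun X Y => ?_
    rw [← hsum, huniv, Finset.sum_pair h01, hprin, hprin]
  · rintro (h2 | ⟨U₁, U₂, h, h1, h2⟩)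
    · exact hbal 2 (by norm_num) h2
    · rw [← Fintype.card_fin k]
      exact C.card_eq_two_of_directSum n hsum hpos h h1 h2
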